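/- An instance-solution problem $\mathsf P$ consists of a set of instances and, for each instance, a set of solutions, all coded as elements of $\mathbb N^{\mathbb N}$. $\mathsf P$ is Weihrauch reducible to $\mathsf Q$, written $\mathsf P\le_{\mathrm W}\mathsf Q$, if there are Turing functionals $H,K$ such that for every $\mathsf P$-instance $x$, $H(x)$ is a $\mathsf Q$-instance, and for every $\mathsf Q$-solution $v$ to $H(x)$, $K(x\oplus v)$ is a $\mathsf P$-solution to $x$. We write $\mathsf P\lneq_{\mathrm W}\mathsf Q$ if $\mathsf P\le_{\mathrm W}\mathsf Q$ and $\mathsf Q\not\le_{\mathrm W}\mathsf P$. The parallel product $\mathsf P\times\mathsf Q$ has as instances the pairs $(x_0,x_1)$ of a $\mathsf P$-instance and a $\mathsf Q$-instance, and as solutions to $(x_0,x_1)$ the pairs $(y_0,y_1)$ such that $y_0$ is a $\mathsf P$-solution to $x_0$ and $y_1$ is a $\mathsf Q$-solution to $x_1$. $\mathsf{ECT}$ is the problem whose instances are the pairs $(n,f)$ with $n\in\mathbb N$ and $f:\mathbb N\to\{0,\dots,n-1\}$, and whose solutions to $(n,f)$ are the $b\in\mathbb N$ such that $\forall x>b\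 \exists y>x\ f(x)=f(y)$. For a linear order $X$, let $X^\omega$ be the set of finite sequences $\langle(b_0,a_0),\dots,(b_n,a_n)\rangle$ with $b_i\in\mathbb N$, $b_0>\dots>b_n$, and $0\ne a_i\in X$ (where $0$ is the least element of $X$; the condition $a_i \neq 0$ is void if $X$ has no least element), ordered lexicographically: a proper prefix of a sequence is smaller than the sequence, and otherwise the first pair in which the two sequences differ decides, where $(b,a)>(b',a')$ if $b>b'$, or $b=b'$ and $a>_Xa'$. $\mathsf{WOP}(X\mapsto X^\omega)$ is the problem whose instances consist of a linear order $(X,\le_X)$ with $X\subseteq\mathbb N$ and an infinite strictly decreasing sequence $\sigma=(\sigma_i)_{i\ge0}$ in $X^\omega$, and whose solutions are the infinite strictly decreasing sequences $\sigma'=(\sigma'_i)_{i\ge 0}$ in $X$ that are contained in $\sigma$, i.e. for which there are $t_0\le t_1\le\cdots$ such that, for each $i$, $\sigma'_i$ is one of the coefficients $a_j$ of $\sigma_{t_i}$. Then $$\mathsf{WOP}(X\mapsto X^\omega)\ \lneq_{\mathrm W}\ \mathsf{ECT}\times\mathsf{WOP}(X\mapsto X^\omega).$$ -/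

import Mathlib

namespace Weihrauch

/-! ### Turing functionals -/

/-- Turing functionals (partial recursive functionals): the functions `Φ` that map an oracle
`f : ℕ → ℕ` to a partial function `Φ f : ℕ →. ℕ` and that are computed by one program, uniformly in
the oracle. They form the least class that contains zero, successor, the two projections of the
pairing function and the oracle itself, and that is closed under pairing, composition, primitive
recursion and unbounded search. The clauses are those of `Nat.RecursiveIn`, with the oracle as a
parameter. -/
inductive TuringFunctional : ((ℕ → ℕ) → ℕ →. ℕ) → Prop
  | zero : TuringFunctional fun _ _ => Part.some 0
  | succ : TuringFunctional fun _ n => Part.some (n + 1)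
  | left : TuringFunctional fun _ n => Part.some n.unpair.1
  | right : TuringFunctional fun _ n => Part.some n.unpair.2
  | oracle : TuringFunctional fun f n => Part.some (f n)
  | pair {Φ Ψ : (ℕ → ℕ) → ℕ →. ℕ} (hΦ : TuringFunctional Φ) (hΨ : TuringFunctional Ψ) :
      TuringFunctional fun f n => (Φ f n).bind fun a => (Ψ f n).map fun b => Nat.pair a b
  | comp {Φ Ψ : (ℕ → ℕ) → ℕ →. ℕ} (hΦ : TuringFunctional Φ) (hΨ : TuringFunctional Ψ) :
      TuringFunctional fun f n => (Ψ f n).bind fun a => Φ f a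
  | prec {Φ Ψ : (ℕ → ℕ) → ℕ →. ℕ} (hΦ : TuringFunctional Φ) (hΨ : TuringFunctional Ψ) :
      TuringFunctional fun f n =>
        Nat.rec (motive := fun _ => Part ℕ) (Φ f n.unpair.1)
          (fun y ih => ih.bind fun i => Ψ f (Nat.pair n.unpair.1 (Nat.pair y i))) n.unpair.2
  | rfind {Φ : (ℕ → ℕ) → ℕ →. ℕ} (hΦ : TuringFunctional Φ) :
      TuringFunctional fun f a =>
        Nat.rfind fun n => (Φ f (Nat.pair a n)).map fun m => decide (m = 0)

/-- `Maps Φ x y`: the functional `Φ` is total on the oracle `x`, and `Φ x` is the sequence `y`. -/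
def Maps (Φ : (ℕ → ℕ) → ℕ →. ℕ) (x y : ℕ → ℕ) : Prop :=
  ∀ n, y n ∈ Φ x n

/-- The join `x ⊕ y`: `x` on the even and `y` on the odd places. -/
def join (x y : ℕ → ℕ) : ℕ → ℕ :=
  fun n => if n % 2 = 0 then x (n / 2) else y (n / 2)

/-- First component of `p`, read as the join of two sequences. -/
def fstPart (p : ℕ → ℕ) : ℕ → ℕ := fun n => p (2 * n)

/-- Second component of `p`, read as the join of two sequences. -/
def sndPart (p : ℕ → ℕ) : ℕ → ℕ := fun n => p (2 * n + 1)

/-! ### Problems and Weihrauch reducibility -/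

/-- An instance-solution problem, whose instances and solutions are (coded as) elements of `ℕ^ℕ`. -/
structure Problem where
  /-- `x` is an instance. -/
  IsInstance : (ℕ → ℕ) → Prop
  /-- `y` is a solution to the instance `x`. -/
  IsSolution : (ℕ → ℕ) → (ℕ → ℕ) → Prop

/-- Weihrauch reducibility. -/
def WeihrauchLE (P Q : Problem) : Prop :=
  ∃ H K : (ℕ → ℕ) → ℕ →. ℕ, TuringFunctional H ∧ TuringFunctional K ∧
    ∀ x, P.IsInstance x → ∃ u, Maps H x u ∧ Q.IsInstance u ∧
      ∀ v, Q.IsSolution u v → ∃ y, Maps K (join x v) y ∧ P.IsSolution x y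

/-- `P` is strictly Weihrauch-below `Q`. -/
def WeihrauchLT (P Q : Problem) : Prop :=
  WeihrauchLE P Q ∧ ¬ WeihrauchLE Q P

/-- The parallel product of two problems; pairs are coded by the join. -/
def Problem.prod (P Q : Problem) : Problem where
  IsInstance x := P.IsInstance (fstPart x) ∧ Q.IsInstance (sndPart x)
  IsSolution x y := P.IsSolution (fstPart x) (fstPart y) ∧ Q.IsSolution (sndPart x) (sndPart y)

/-! ### Eventually constant palette tail -/

/-- The problem `ECT`. The pair `(n, f)` is coded by the sequence `n, f 0, f 1, …`; a sequence `y`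
codes the natural number `y 0`. -/
def ECT : Problem where
  IsInstance p := ∀ i, p (i + 1) < p 0
  IsSolution p y := ∀ x > y 0, ∃ z > x, p (x + 1) = p (z + 1)

/-! ### The operator `X ↦ X ^ ω` -/

/-- The strict part of `le`. -/
def strict (le : ℕ → ℕ → Prop) (a b : ℕ) : Prop := le a b ∧ ¬ le b a

/-- The elements `⟨(b₀, a₀), …, (bₙ, aₙ)⟩` of `X ^ ω`, for a set `X` of natural numbers that is
linearly ordered by `le`: the exponents `bᵢ` are strictly decreasing, and each coefficient `aᵢ` is a
nonzero element of `X`, that is, not the least element of `X` (if `X` has one). -/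
def IsTerm (X : Set ℕ) (le : ℕ → ℕ → Prop) (s : List (ℕ × ℕ)) : Prop :=
  (s.map Prod.fst).Pairwise (· > ·) ∧
    ∀ u ∈ s, u.2 ∈ X ∧ ∃ c ∈ X, strict le c u.2

/-- The lexicographic order on `X ^ ω`: proper prefixes are smaller, and otherwise the first
difference decides, where pairs are compared by exponent first and by coefficient second. -/
def termLT (le : ℕ → ℕ → Prop) (s t : List (ℕ × ℕ)) : Prop :=
  List.Lex (Prod.Lex (· < ·) (strict le)) s t

/-! ### The problem `WOP (X ↦ X ^ ω)` -/

/-- An instance `p` of `WOP (X ↦ X ^ ω)` is the join of (the characteristic function of) `X`, the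
join of (the characteristic function of) the order of `X`, and a sequence of codes of elements of
`X ^ ω`. This is the set `X`. -/
def carrier (p : ℕ → ℕ) : Set ℕ := {a | fstPart p a = 1}

/-- The order relation `≤_X` coded by `p`. -/
def orderRel (p : ℕ → ℕ) (a b : ℕ) : Prop := fstPart (sndPart p) (Nat.pair a b) = 1

/-- The sequence of finite sequences of pairs coded by `p`. -/
def termSeq (p : ℕ → ℕ) (n : ℕ) : List (ℕ × ℕ) :=
  Denumerable.ofNat (List (ℕ × ℕ)) (sndPart (sndPart p) n)

/-- The problem `WOP (X ↦ X ^ ω)`: given a linear order `X` and an infinite decreasing sequence `σ`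
in `X ^ ω`, find an infinite decreasing sequence in `X` that is contained in `σ`, i.e. whose `i`-th
entry is a coefficient of the term `σ (t i)`, with `t i ≤ t j` for `i < j`. -/
def WOPpowOmega : Problem where
  IsInstance p :=
    IsLinearOrder (carrier p) (fun a b : carrier p => orderRel p a b) ∧
      (∀ n, IsTerm (carrier p) (orderRel p) (termSeq p n)) ∧
      ∀ n, termLT (orderRel p) (termSeq p (n + 1)) (termSeq p n)
  IsSolution p y :=
    (∀ i, y i ∈ carrier p) ∧
      (∀ i, strict (orderRel p) (y (i + 1)) (y i)) ∧
      ∃ t : ℕ → ℕ, Monotone t ∧ ∀ i, ∃ b, (b, y i) ∈ termSeq p (t i)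

end Weihrauch

namespace Weihrauch

open Filter Topology

/-! ### The product reduces to its second factor from below -/

/-! The reduction from left to right adjoins a trivial colouring. Strictness is a continuity and
Baire category argument. Suppose `H`, `K` reduce the product to `WOPpowOmega`. Each `w` in Baire
space gives a product instance `prodInstance w`: the colouring marks where `w` is `1`, and the
descent of terms is carried by the leading coefficients if `w` takes the value `2` infinitely often,
by the other ones if not (`unpair_eq_zero`, `exists_unpair_ne_zero`). Let `U w` be the instance that
`H` computes. By `exists_column`, on some open set all `U w` share a position in the terms whose
coefficient, for generic `w`, drops forever; these drops form a solution.

At a generic `w₁`, `K` reads finitely much of the column solution `v₁` and commits to a bound for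
the colouring. A nearby `w₂` uses colour `1` once beyond that bound and is `0` afterwards, so the
part of `v₁` already read cannot be extended to a solution of `U w₂`. Hence a late solution `v` of
`U w₂` never goes below the last entry of that part. Since `w₂` has finitely many `2`s, `K` on `v`
must output a non-leading coefficient, again after finitely much of `v`. At a generic `w₃` near `w₂`
the column drops forever, hence below everything read from `v`, and so extends it to a solution. But
`w₃` has infinitely many `2`s, so the non-leading coefficient is wrong. -/

/-- Primitive recursive functions are Turing functionals that ignore the oracle. -/
theorem TuringFunctional.of_primrec {g : ℕ → ℕ} (hg : Nat.Primrec g) :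
    TuringFunctional fun _ n => Part.some (g n) := by
  induction hg with
  | zero => exact .zero
  | succ => exact .succ
  | left => exact .left
  | right => exact .right
  | pair _ _ hf hg =>
    convert TuringFunctional.pair hf hg using 3
    simp
  | comp _ _ hf hg =>
    convert TuringFunctional.comp hf hg using 3
    simp
  | @prec f g _ _ hf hg =>
    refine Eq.mp (congrArg TuringFunctional ?_) (TuringFunctional.prec hf hg)
    funext _ n
    simp only [Nat.unpaired]
    induction n.unpair.2 with
    | zero => rfl
    | succ k ih =>
      dsimp only
      rw [ih, Part.bind_some]

/-- Reading the oracle at a primitive recursive place is a Turing functional. -/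
theorem TuringFunctional.oracle_comp {g : ℕ → ℕ} (hg : Nat.Primrec g) :
    TuringFunctional fun f n => Part.some (f (g n)) := by
  convert TuringFunctional.comp .oracle (.of_primrec hg) using 3
  simp

/-- Primitive recursive processing of one oracle query is a Turing functional. -/
theorem TuringFunctional.comp_pair_oracle {g h : ℕ → ℕ} (hg : Nat.Primrec g)
    (hh : Nat.Primrec h) :
    TuringFunctional fun f n => Part.some (h (Nat.pair n (f (g n)))) := by
  convert TuringFunctional.comp (.of_primrec hh)
    (.pair (.of_primrec Nat.Primrec.id) (.oracle_comp hg)) using 3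
  simp

theorem fstPart_join (x y : ℕ → ℕ) : fstPart (join x y) = x := by
  funext n
  simp [fstPart, join]

theorem sndPart_join (x y : ℕ → ℕ) : sndPart (join x y) = y := by
  funext n
  have h : (2 * n + 1) / 2 = n := by omega
  simp [sndPart, join, Nat.add_mod, h]

/-- The instance is paired with the colouring in one colour, and the bound returned for it is
discarded. -/
theorem WOPpowOmega_le_prod : WeihrauchLE WOPpowOmega (ECT.prod WOPpowOmega) := by
  have hdiv : Nat.Primrec fun n => n / 2 :=
    Primrec.nat_iff.1 (Primrec.nat_div.comp .id (.const 2))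
  -- Applied to `Nat.pair n (x (n / 2))`: even places spell `1, 0, 0, …`, the code of the one-colour
  -- instance, and odd places copy `x`.
  have hcase : Nat.Primrec fun m =>
      if m.unpair.1 % 2 = 0 then (if m.unpair.1 = 0 then 1 else 0) else m.unpair.2 := by
    have h1 : Primrec fun m : ℕ => m.unpair.1 := Primrec.fst.comp .unpair
    have h2 : Primrec fun m : ℕ => m.unpair.2 := Primrec.snd.comp .unpair
    exact Primrec.nat_iff.1 (.ite (Primrec.eq.comp (Primrec.nat_mod.comp h1 (.const 2)) (.const 0))
      (.ite (Primrec.eq.comp h1 (.const 0)) (.const 1) (.const 0)) h2)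
  -- Entry `n` of the second component of `v` is `v (2 * n + 1)`, which sits at place `2 * (2 * n +
  -- 1) + 1` of `join x v`.
  have hlin : Nat.Primrec fun n => 4 * n + 3 :=
    Primrec.nat_iff.1 (Primrec.nat_add.comp (Primrec.nat_mul.comp (.const 4) .id) (.const 3))
  refine ⟨_, _, .comp_pair_oracle hdiv hcase, .oracle_comp hlin, fun x hx => ?_⟩
  refine ⟨join (fun n => if n = 0 then 1 else 0) x, fun n => ?_, ⟨?_, ?_⟩, fun v hv => ?_⟩
  · have h : n % 2 = 0 → (n / 2 = 0 ↔ n = 0) := by omega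
    by_cases hn : n % 2 = 0 <;> simp [join, hn, h]
  · simp [fstPart_join, ECT]
  · simpa [sndPart_join] using hx
  · refine ⟨sndPart v, fun n => ?_, by simpa [sndPart_join] using hv.2⟩
    have h1 : (4 * n + 3) % 2 = 1 := by omega
    have h2 : (4 * n + 3) / 2 = 2 * n + 1 := by omega
    simp [join, sndPart, h1, h2]

/-! ### Continuity of Turing functionals -/

theorem eventually_apply_eq (f : ℕ → ℕ) (n : ℕ) : ∀ᶠ g in 𝓝 f, g n = f n :=
  (continuous_apply n).continuousAt.eventually (show ∀ᶠ k in 𝓝 (f n), k = f n by simp)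

/-- A converging computation uses only finitely many values of the oracle. -/
theorem TuringFunctional.eventually_mem {Φ : (ℕ → ℕ) → ℕ →. ℕ} (hΦ : TuringFunctional Φ)
    {f : ℕ → ℕ} {n y : ℕ} (h : y ∈ Φ f n) : ∀ᶠ g in 𝓝 f, y ∈ Φ g n := by
  induction hΦ generalizing n y with
  | zero => exact .of_forall fun _ => h
  | succ => exact .of_forall fun _ => h
  | left => exact .of_forall fun _ => h
  | right => exact .of_forall fun _ => h
  | oracle =>
    filter_upwards [eventually_apply_eq f n] with g hg
    simpa [hg] using h
  | pair _ _ ihΦ ihΨ =>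
    obtain ⟨a, ha, h'⟩ := Part.mem_bind_iff.1 h
    obtain ⟨b, hb, rfl⟩ := (Part.mem_map_iff _).1 h'
    filter_upwards [ihΦ ha, ihΨ hb] with g h1 h2
    exact Part.mem_bind_iff.2 ⟨a, h1, (Part.mem_map_iff _).2 ⟨b, h2, rfl⟩⟩
  | comp _ _ ihΦ ihΨ =>
    obtain ⟨a, ha, hb⟩ := Part.mem_bind_iff.1 h
    filter_upwards [ihΨ ha, ihΦ hb] with g h1 h2
    exact Part.mem_bind_iff.2 ⟨a, h1, h2⟩
  | prec _ _ ihΦ ihΨ =>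
    induction hk : n.unpair.2 generalizing n y with
    | zero =>
      simp only [hk] at h ⊢
      exact ihΦ h
    | succ k ih =>
      simp only [hk] at h ⊢
      obtain ⟨a, ha, hb⟩ := Part.mem_bind_iff.1 h
      have := @ih (Nat.pair n.unpair.1 k) a (by simpa using ha) (by simp)
      filter_upwards [this, ihΨ hb] with g h1 h2
      exact Part.mem_bind_iff.2 ⟨a, by simpa using h1, h2⟩
  | @rfind Φ _ ih =>
    obtain ⟨h1, h2⟩ := Nat.mem_rfind.1 h
    obtain ⟨a, ha, ha'⟩ := (Part.mem_map_iff _).1 h1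
    have h3 : ∀ m ∈ Set.Iio y, ∀ᶠ g in 𝓝 f,
        false ∈ (Φ g (Nat.pair n m)).map fun m => decide (m = 0) :=
      fun m hm => by
        obtain ⟨b, hb, hb'⟩ := (Part.mem_map_iff _).1 (h2 hm)
        filter_upwards [ih hb] with g hg
        exact (Part.mem_map_iff _).2 ⟨b, hg, hb'⟩
    filter_upwards [ih ha, (eventually_all_finite (Set.finite_Iio y)).2 h3] with g h4 h5
    exact Nat.mem_rfind.2 ⟨(Part.mem_map_iff _).2 ⟨a, h4, ha'⟩, fun hm => h5 _ hm⟩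

/-- If `Φ` is total on the oracles `x w` then the sequence that it computes depends continuously
on `w`. -/
theorem TuringFunctional.continuous_of_maps {W : Type*} [TopologicalSpace W]
    {Φ : (ℕ → ℕ) → ℕ →. ℕ} (hΦ : TuringFunctional Φ) {x u : W → ℕ → ℕ} (hx : Continuous x)
    (hu : ∀ w, Maps Φ (x w) (u w)) : Continuous u := by
  refine continuous_pi fun n => continuous_iff_continuousAt.2 fun w => ?_
  rw [ContinuousAt, nhds_discrete ℕ, tendsto_pure]
  filter_upwards [hx.continuousAt.eventually (hΦ.eventually_mem (hu w n))] with w' hw'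
  exact Part.mem_unique (hu w' n) hw'

theorem exists_forall_lt_of_mem_nhds {f : ℕ → ℕ} {s : Set (ℕ → ℕ)} (hs : s ∈ 𝓝 f) :
    ∃ n, ∀ g : ℕ → ℕ, (∀ i < n, g i = f i) → g ∈ s := by
  obtain ⟨_, ⟨x, n, rfl⟩, hf, hn⟩ :=
    (PiNat.isTopologicalBasis_cylinders (fun _ : ℕ => ℕ)).mem_nhds_iff.1 hs
  refine ⟨n, fun g hg => hn ?_⟩
  rw [PiNat.mem_cylinder_iff] at hf ⊢
  exact fun i hi => (hg i hi).trans (hf i hi)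

theorem continuous_join : Continuous fun p : (ℕ → ℕ) × (ℕ → ℕ) => join p.1 p.2 := by
  refine continuous_pi fun n => ?_
  by_cases h : n % 2 = 0
  · simp only [join, h, if_true]
    fun_prop
  · simp only [join, h, if_false]
    fun_prop

theorem _root_.Continuous.join {W : Type*} [TopologicalSpace W] {x y : W → ℕ → ℕ}
    (hx : Continuous x) (hy : Continuous y) : Continuous fun w => join (x w) (y w) :=
  continuous_join.comp (hx.prodMk hy)

/-- A converging computation from `x w ⊕ v` uses only a finite part of `v`, and an open condition
on `w`. -/
theorem TuringFunctional.eventually_mem_join {W : Type*} [TopologicalSpace W]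
    {Φ : (ℕ → ℕ) → ℕ →. ℕ} (hΦ : TuringFunctional Φ) {x : W → ℕ → ℕ} (hx : Continuous x)
    {w : W} {v : ℕ → ℕ} {n y : ℕ} (h : y ∈ Φ (join (x w) v) n) :
    ∃ k, ∀ᶠ w' in 𝓝 w, ∀ v' : ℕ → ℕ, (∀ i ≤ k, v' i = v i) → y ∈ Φ (join (x w') v') n := by
  have hc : Continuous fun p : W × (ℕ → ℕ) => join (x p.1) p.2 :=
    (hx.comp continuous_fst).join continuous_snd
  have he : ∀ᶠ p in 𝓝 (w, v), y ∈ Φ (join (x p.1) p.2) n :=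
    hc.continuousAt.eventually (hΦ.eventually_mem h)
  rw [nhds_prod_eq, eventually_prod_iff] at he
  obtain ⟨p, hp, q, hq, hpq⟩ := he
  obtain ⟨k, hk⟩ := exists_forall_lt_of_mem_nhds hq
  refine ⟨k, ?_⟩
  filter_upwards [hp] with w' hw' v' hv'
  exact hpq hw' (hk v' fun i hi => hv' i hi.le)

/-! ### Decreasing sequences of terms -/

section Order

variable {X : Set ℕ} {le : ℕ → ℕ → Prop}

theorem not_strict_self (a : ℕ) : ¬ strict le a a := fun h => h.2 h.1

theorem strict_trans (hX : IsLinearOrder X fun a b : X => le a b) {a b c : ℕ} (ha : a ∈ X)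
    (hb : b ∈ X) (hc : c ∈ X) (hab : strict le a b) (hbc : strict le b c) : strict le a c :=
  ⟨hX.trans ⟨a, ha⟩ ⟨b, hb⟩ ⟨c, hc⟩ hab.1 hbc.1,
    fun h => hab.2 (hX.trans ⟨b, hb⟩ ⟨c, hc⟩ ⟨a, ha⟩ hbc.1 h)⟩

theorem strict_of_strict_of_not_strict (hX : IsLinearOrder X fun a b : X => le a b) {a b c : ℕ}
    (ha : a ∈ X) (hb : b ∈ X) (hc : c ∈ X) (hab : strict le a b) (hcb : ¬ strict le c b) :
    strict le a c := by
  have hbc : le b c := by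
    rcases hX.total ⟨b, hb⟩ ⟨c, hc⟩ with h | h
    · exact h
    · by_contra h'
      exact hcb ⟨h, h'⟩
  exact ⟨hX.trans ⟨a, ha⟩ ⟨b, hb⟩ ⟨c, hc⟩ hab.1 hbc,
    fun h => hab.2 (hX.trans ⟨b, hb⟩ ⟨c, hc⟩ ⟨a, ha⟩ hbc h)⟩

theorem strict_prodLex_irrefl (u : ℕ × ℕ) : ¬ Prod.Lex (· < ·) (strict le) u u := by
  simp [Prod.lex_def, not_strict_self]

theorem termLT_of_append {pre s t : List (ℕ × ℕ)} (h : termLT le (pre ++ s) (pre ++ t)) :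
    termLT le s t := by
  induction pre with
  | nil => exact h
  | cons u pre ih =>
    cases h with
    | rel h => exact absurd h (strict_prodLex_irrefl u)
    | cons h => exact ih h

end Order

/-- The coefficient in place `j` of a term (zero if there is no such place). -/
def coeffAt (j : ℕ) (s : List (ℕ × ℕ)) : ℕ := (s.getD j (0, 0)).2

@[simp]
theorem coeffAt_append (pre : List (ℕ × ℕ)) (b c : ℕ) (r : List (ℕ × ℕ)) :
    coeffAt pre.length (pre ++ (b, c) :: r) = c := by
  simp [coeffAt]

/-- From time `s` on, all terms of the sequence `ρ` begin with `pre`, followed by a pair with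
exponent `b`. -/
def IsColumn (ρ : ℕ → List (ℕ × ℕ)) (pre : List (ℕ × ℕ)) (b s : ℕ) : Prop :=
  ∀ t ≥ s, ∃ c r, ρ t = pre ++ (b, c) :: r

theorem IsColumn.eq {ρ : ℕ → List (ℕ × ℕ)} {pre : List (ℕ × ℕ)} {b s t : ℕ}
    (h : IsColumn ρ pre b s) (ht : s ≤ t) :
    ∃ r, ρ t = pre ++ (b, coeffAt pre.length (ρ t)) :: r := by
  obtain ⟨c, r, h⟩ := h t ht
  exact ⟨r, by simp [h]⟩

theorem IsColumn.mem {ρ : ℕ → List (ℕ × ℕ)} {pre : List (ℕ × ℕ)} {b s t : ℕ}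
    (h : IsColumn ρ pre b s) (ht : s ≤ t) : (b, coeffAt pre.length (ρ t)) ∈ ρ t := by
  obtain ⟨c, r, h⟩ := h t ht
  simp [h]

/-- The coefficients in a column decrease weakly. -/
theorem IsColumn.coeff_le {X : Set ℕ} {le : ℕ → ℕ → Prop} {ρ : ℕ → List (ℕ × ℕ)}
    {pre : List (ℕ × ℕ)} {b s : ℕ} (h : IsColumn ρ pre b s)
    (hX : IsLinearOrder X fun a b : X => le a b) (hterm : ∀ t, IsTerm X le (ρ t))
    (hdec : ∀ t, termLT le (ρ (t + 1)) (ρ t)) {t t' : ℕ} (ht : s ≤ t) (htt : t ≤ t') :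
    coeffAt pre.length (ρ t') = coeffAt pre.length (ρ t) ∨
      strict le (coeffAt pre.length (ρ t')) (coeffAt pre.length (ρ t)) := by
  have hmem : ∀ u ≥ s, coeffAt pre.length (ρ u) ∈ X := fun u hu =>
    ((hterm u).2 _ (h.mem hu)).1
  induction t', htt using Nat.le_induction with
  | base => exact .inl rfl
  | succ u hu ih =>
    have hstep : coeffAt pre.length (ρ (u + 1)) = coeffAt pre.length (ρ u) ∨
        strict le (coeffAt pre.length (ρ (u + 1))) (coeffAt pre.length (ρ u)) := by
      obtain ⟨c, r, h1⟩ := h u (ht.trans hu)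
      obtain ⟨c', r', h2⟩ := h (u + 1) (by omega)
      have h3 := hdec u
      rw [h1, h2] at h3 ⊢
      simp only [coeffAt_append]
      cases termLT_of_append h3 with
      | rel h => simpa [Prod.lex_def] using Or.inr h
      | cons h => exact .inl rfl
    rcases hstep with h1 | h1
    · rw [h1]
      exact ih
    · rcases ih with h2 | h2
      · rw [← h2]
        exact .inr h1
      · exact .inr (strict_trans hX (hmem _ (by omega)) (hmem _ (by omega)) (hmem _ ht) h1 h2)

/-- In a family of decreasing sequences of terms that depends continuously on a parameter there is,
over some open set of parameters, a column whose coefficient changes again and again for a dense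
set of parameters. -/
theorem exists_column {W : Type*} [TopologicalSpace W] [Nonempty W] {X : W → Set ℕ}
    {le : W → ℕ → ℕ → Prop} {ρ : W → ℕ → List (ℕ × ℕ)}
    (hρ : ∀ w t, ∀ᶠ w' in 𝓝 w, ρ w' t = ρ w t)
    (hterm : ∀ w t, IsTerm (X w) (le w) (ρ w t))
    (hdec : ∀ w t, termLT (le w) (ρ w (t + 1)) (ρ w t)) :
    ∃ (O : Set W) (pre : List (ℕ × ℕ)) (b s : ℕ), IsOpen O ∧ O.Nonempty ∧
      (∀ w ∈ O, IsColumn (ρ w) pre b s) ∧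
      ∀ O' ⊆ O, IsOpen O' → O'.Nonempty → ∀ s' ≥ s, ∃ w ∈ O', ∃ t ≥ s',
        coeffAt pre.length (ρ w t) ≠ coeffAt pre.length (ρ w s') := by
  have hnbhd : ∀ (O : Set W), IsOpen O → ∀ w ∈ O, ∀ t, ∃ O' ⊆ O, IsOpen O' ∧ w ∈ O' ∧
      ∀ w' ∈ O', ρ w' t = ρ w t := by
    intro O hO w hw t
    obtain ⟨O', h1, h2, h3⟩ := eventually_nhds_iff.1 (hρ w t)
    exact ⟨O ∩ O', Set.inter_subset_left, hO.inter h2, ⟨hw, h3⟩, fun w' hw' => h1 w' hw'.2⟩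
  have hhead : ∀ w pre t b c r b' c' r', ρ w t = pre ++ (b, c) :: r →
      ρ w (t + 1) = pre ++ (b', c') :: r' → b' ≤ b := by
    intro w pre t b c r b' c' r' h1 h2
    have h := hdec w t
    rw [h1, h2] at h
    cases termLT_of_append h with
    | rel h =>
      rcases (Prod.lex_def).1 h with h | h
      · exact h.le
      · exact h.1.le
    | cons h => exact le_rfl
  have hne : ∀ w pre t r, ρ w t = pre ++ r → (∃ r', ρ w (t + 1) = pre ++ r') → r ≠ [] := by
    rintro w pre t r h1 ⟨r', h2⟩ rfl
    have h := hdec w t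
    rw [h1, h2] at h
    cases termLT_of_append h
  -- Induction on a bound `B` for the exponents that follow the prefix: a failed attempt lengthens
  -- the prefix and lowers the bound.
  have key : ∀ (B : ℕ) (O : Set W) (pre : List (ℕ × ℕ)) (s : ℕ), IsOpen O → O.Nonempty →
      (∀ w ∈ O, ∀ t ≥ s, ∃ b c r, b < B ∧ ρ w t = pre ++ (b, c) :: r) →
      ∃ (O : Set W) (pre : List (ℕ × ℕ)) (b s : ℕ), IsOpen O ∧ O.Nonempty ∧
      (∀ w ∈ O, IsColumn (ρ w) pre b s) ∧
      ∀ O' ⊆ O, IsOpen O' → O'.Nonempty → ∀ s' ≥ s, ∃ w ∈ O', ∃ t ≥ s',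
        coeffAt pre.length (ρ w t) ≠ coeffAt pre.length (ρ w s') := by
    intro B
    induction B using Nat.strong_induction_on with
    | _ B ih =>
    intro O pre s hO hOne hB
    classical
    -- The least exponent that ever follows `pre` over `O` stays once it appears: it cannot grow by
    -- `hhead`, nor shrink by minimality.
    have hex : ∃ b, ∃ w ∈ O, ∃ t ≥ s, ∃ c r, ρ w t = pre ++ (b, c) :: r := by
      obtain ⟨w, hw⟩ := hOne
      obtain ⟨b, c, r, -, h⟩ := hB w hw s le_rfl
      exact ⟨b, w, hw, s, le_rfl, c, r, h⟩
    obtain ⟨w₁, hw₁, t₁, ht₁, c₁, r₁, h₁⟩ := Nat.find_spec hex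
    have hmin := fun b => Nat.find_min' hex (m := b)
    generalize Nat.find hex = b at h₁ hmin
    have hbB : b < B := by
      obtain ⟨b', c', r', hb', h'⟩ := hB w₁ hw₁ t₁ ht₁
      rw [h₁] at h'
      simp only [List.append_cancel_left_eq, List.cons.injEq, Prod.mk.injEq] at h'
      omega
    obtain ⟨O₁, hO₁, hO₁open, hwO₁, hO₁ρ⟩ := hnbhd O hO w₁ hw₁ t₁
    have hcol : ∀ w ∈ O₁, IsColumn (ρ w) pre b t₁ := by
      intro w hw t ht
      induction t, ht using Nat.le_induction with
      | base => exact ⟨c₁, r₁, by rw [hO₁ρ w hw, h₁]⟩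
      | succ t ht ih =>
        obtain ⟨c, r, h⟩ := ih
        obtain ⟨b', c', r', -, h'⟩ := hB w (hO₁ hw) (t + 1) (by omega)
        have h2 := hhead _ _ _ _ _ _ _ _ _ h h'
        have h3 := hmin b' ⟨w, hO₁ hw, t + 1, by omega, c', r', h'⟩
        obtain rfl : b' = b := by omega
        exact ⟨c', r', h'⟩
    by_cases hdense : ∀ O' ⊆ O₁, IsOpen O' → O'.Nonempty → ∀ s' ≥ t₁, ∃ w ∈ O', ∃ t ≥ s',
        coeffAt pre.length (ρ w t) ≠ coeffAt pre.length (ρ w s')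
    · exact ⟨O₁, pre, b, t₁, hO₁open, ⟨w₁, hwO₁⟩, hcol, hdense⟩
    · push Not at hdense
      obtain ⟨O₂, hO₂, hO₂open, ⟨w₂, hw₂⟩, s', hs', hconst⟩ := hdense
      -- Over `O₂` the coefficient is constant in time; shrinking to `O₃` makes it the same number
      -- for all parameters, so it can join the prefix.
      obtain ⟨O₃, hO₃, hO₃open, hwO₃, hO₃ρ⟩ := hnbhd O₂ hO₂open w₂ hw₂ s'
      have hpre : ∀ w ∈ O₃, ∀ t ≥ s', ∃ r,
          ρ w t = (pre ++ [(b, coeffAt pre.length (ρ w₂ s'))]) ++ r := by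
        intro w hw t ht
        obtain ⟨r, hr⟩ := (hcol w (hO₂ (hO₃ hw))).eq (hs'.trans ht)
        rw [hconst w (hO₃ hw) t ht, hO₃ρ w hw] at hr
        exact ⟨r, by simp [hr]⟩
      refine ih b hbB O₃ (pre ++ [(b, coeffAt pre.length (ρ w₂ s'))]) s' hO₃open ⟨w₂, hwO₃⟩
        fun w hw t ht => ?_
      obtain ⟨r, hr⟩ := hpre w hw t ht
      have hrne := hne w _ t r hr (hpre w hw (t + 1) (by omega))
      obtain ⟨⟨b', c'⟩, r', rfl⟩ := List.exists_cons_of_ne_nil hrne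
      refine ⟨b', c', r', ?_, hr⟩
      have h := (hterm w t).1
      rw [hr] at h
      simp only [List.map_append, List.map_cons, List.pairwise_append] at h
      exact h.2.2 b (by simp) b' (by simp)
  have hcons : ∀ w t, ∃ b c r, ρ w t = [] ++ (b, c) :: r := by
    intro w t
    have hrne := hne w [] t (ρ w t) rfl ⟨_, rfl⟩
    obtain ⟨⟨b, c⟩, r, h⟩ := List.exists_cons_of_ne_nil hrne
    exact ⟨b, c, r, h⟩
  obtain ⟨w₀⟩ := ‹Nonempty W›
  obtain ⟨O, -, hO, hw₀, hOρ⟩ := hnbhd Set.univ isOpen_univ w₀ trivial 0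
  obtain ⟨b₀, c₀, r₀, h₀⟩ := hcons w₀ 0
  refine key (b₀ + 1) O [] 0 hO ⟨w₀, hw₀⟩ fun w hw t _ => ?_
  induction t with
  | zero => exact ⟨b₀, c₀, r₀, by omega, by rw [hOρ w hw, h₀]⟩
  | succ t ih =>
    obtain ⟨b, c, r, hb, h⟩ := ih (Nat.zero_le _)
    obtain ⟨b', c', r', h'⟩ := hcons w (t + 1)
    have := hhead _ _ _ _ _ _ _ _ _ h h'
    exact ⟨b', c', r', by omega, h'⟩

/-! ### Solutions of `WOP (X ↦ X ^ ω)` -/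

/-- A column whose coefficient changes infinitely often contains a solution, which may start
arbitrarily late. -/
theorem exists_solution_of_column {p : ℕ → ℕ} (hp : WOPpowOmega.IsInstance p)
    {pre : List (ℕ × ℕ)} {b s : ℕ} (hcol : IsColumn (termSeq p) pre b s)
    (hdrop : ∀ s' ≥ s, ∃ t ≥ s',
      coeffAt pre.length (termSeq p t) ≠ coeffAt pre.length (termSeq p s')) {T : ℕ} (hT : s ≤ T) :
    ∃ τ : ℕ → ℕ, τ 0 = T ∧ StrictMono τ ∧
      (∀ i, strict (orderRel p) (coeffAt pre.length (termSeq p (τ (i + 1))))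
        (coeffAt pre.length (termSeq p (τ i)))) ∧
      ∀ i, ∃ b, (b, coeffAt pre.length (termSeq p (τ i))) ∈ termSeq p (τ i) := by
  choose! next hnext hne using hdrop
  have hs : ∀ i, s ≤ next^[i] T := by
    intro i
    induction i with
    | zero => exact hT
    | succ i ih =>
      rw [Function.iterate_succ_apply']
      exact ih.trans (hnext _ ih)
  refine ⟨fun i => next^[i] T, rfl, strictMono_nat_of_lt_succ fun i => ?_, fun i => ?_,
    fun i => ⟨b, hcol.mem (hs i)⟩⟩
  · simp only [Function.iterate_succ_apply']
    refine (hnext _ (hs i)).lt_of_ne fun h => hne _ (hs i) ?_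
    rw [← h]
  · simp only [Function.iterate_succ_apply']
    exact (hcol.coeff_le hp.1 hp.2.1 hp.2.2 (hs i) (hnext _ (hs i))).resolve_left (hne _ (hs i))

/-- Every instance has solutions that start arbitrarily late. -/
theorem exists_solution {p : ℕ → ℕ} (hp : WOPpowOmega.IsInstance p) (T : ℕ) :
    ∃ v t : ℕ → ℕ, T ≤ t 0 ∧ Monotone t ∧ (∀ i, strict (orderRel p) (v (i + 1)) (v i)) ∧
      ∀ i, ∃ b, (b, v i) ∈ termSeq p (t i) := by
  -- Over a one-point space continuity is void, and a dense set of parameters is the single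
  -- parameter itself.
  obtain ⟨O, pre, b, s, hO, ⟨w, hw⟩, hcol, hdrop⟩ := exists_column (W := Unit)
    (ρ := fun _ => termSeq p) (by simp) (fun _ => hp.2.1) (fun _ => hp.2.2)
  obtain ⟨τ, h0, hτ, h1, h2⟩ := exists_solution_of_column hp (hcol w hw)
    (fun s' hs' => (hdrop O subset_rfl hO ⟨w, hw⟩ s' hs').choose_spec.2) (le_max_left s T)
  exact ⟨_, τ, h0 ▸ le_max_right s T, hτ.monotone, h1, h2⟩

theorem mem_carrier_of_mem {p : ℕ → ℕ} (hp : WOPpowOmega.IsInstance p) {t a : ℕ}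
    (h : ∃ b, (b, a) ∈ termSeq p t) : a ∈ carrier p :=
  ((hp.2.1 t).2 _ h.choose_spec).1

/-- A finite decreasing sequence followed by an infinite one is a solution. -/
theorem isSolution_splice {p : ℕ → ℕ} (hp : WOPpowOmega.IsInstance p) {k : ℕ} {v t v' t' : ℕ → ℕ}
    (ht : Monotone t) (hv : ∀ i < k, strict (orderRel p) (v (i + 1)) (v i))
    (hmem : ∀ i ≤ k, ∃ b, (b, v i) ∈ termSeq p (t i))
    (ht' : Monotone t') (hv' : ∀ i, strict (orderRel p) (v' (i + 1)) (v' i))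
    (hmem' : ∀ i, ∃ b, (b, v' i) ∈ termSeq p (t' i))
    (htt : t k ≤ t' 0) (hlt : strict (orderRel p) (v' 0) (v k)) :
    WOPpowOmega.IsSolution p fun i => if i ≤ k then v i else v' (i - (k + 1)) := by
  have hall : ∀ i, ∃ b, (b, if i ≤ k then v i else v' (i - (k + 1))) ∈
      termSeq p (if i ≤ k then t i else t' (i - (k + 1))) := by
    intro i
    split_ifs with h
    · exact hmem i h
    · exact hmem' _
  refine ⟨fun i => mem_carrier_of_mem hp (hall i), fun i => ?_, _, monotone_nat_of_le_succ ?_, hall⟩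
  · rcases lt_trichotomy i k with h | rfl | h
    · simpa [h.le, show i + 1 ≤ k from h] using hv i h
    · simpa using hlt
    · have h2 : i + 1 - (k + 1) = i - (k + 1) + 1 := by omega
      simpa only [if_neg h.not_ge, if_neg (show ¬ i + 1 ≤ k by omega), h2] using hv' _
  · intro i
    rcases lt_trichotomy i k with h | rfl | h
    · simpa [h.le, show i + 1 ≤ k from h] using ht i.le_succ
    · simpa using htt
    · simpa only [if_neg h.not_ge, if_neg (show ¬ i + 1 ≤ k by omega)] using ht' (by omega)

/-! ### Local constancy of the data of an instance in the parameter -/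

section Continuity

variable {W : Type*} [TopologicalSpace W] {U : W → ℕ → ℕ}

theorem eventually_comp_eq {α : Type*} (hU : Continuous U) (F : (ℕ → ℕ) → α) (n : ℕ)
    (hF : ∀ p q : ℕ → ℕ, p n = q n → F p = F q) (w : W) : ∀ᶠ w' in 𝓝 w, F (U w') = F (U w) := by
  filter_upwards [hU.continuousAt.eventually (eventually_apply_eq (U w) n)] with w' hw'
  exact hF _ _ hw'

theorem eventually_termSeq_eq (hU : Continuous U) (w : W) (t : ℕ) :
    ∀ᶠ w' in 𝓝 w, termSeq (U w') t = termSeq (U w) t :=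
  -- The place of the nested join at which term `t` is stored.
  eventually_comp_eq hU (fun p => termSeq p t) (2 * (2 * t + 1) + 1)
    (fun p q h => by simp [termSeq, sndPart, h]) w

theorem eventually_orderRel_eq (hU : Continuous U) (w : W) (a b : ℕ) :
    ∀ᶠ w' in 𝓝 w, orderRel (U w') a b = orderRel (U w) a b :=
  eventually_comp_eq hU (fun p => orderRel p a b) (2 * (2 * Nat.pair a b) + 1)
    (fun p q h => by simp [orderRel, sndPart, fstPart, h]) w

theorem eventually_strict (hU : Continuous U) {w : W} {a b : ℕ}
    (h : strict (orderRel (U w)) a b) : ∀ᶠ w' in 𝓝 w, strict (orderRel (U w')) a b := by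
  filter_upwards [eventually_orderRel_eq hU w a b, eventually_orderRel_eq hU w b a] with w' h1 h2
  simpa only [strict, h1, h2] using h

/-- Finite parts of a solution persist under small changes of the parameter. -/
theorem eventually_partial_solution (hU : Continuous U) {w : W} {v t : ℕ → ℕ}
    (hv : ∀ i, strict (orderRel (U w)) (v (i + 1)) (v i))
    (hmem : ∀ i, ∃ b, (b, v i) ∈ termSeq (U w) (t i)) (k : ℕ) :
    ∀ᶠ w' in 𝓝 w, (∀ i < k, strict (orderRel (U w')) (v (i + 1)) (v i)) ∧
      ∀ i ≤ k, ∃ b, (b, v i) ∈ termSeq (U w') (t i) := by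
  refine ((eventually_all_finite (Set.finite_Iio k)).2 fun i _ => eventually_strict hU (hv i)).and
    ((eventually_all_finite (Set.finite_Iic k)).2 fun i _ => ?_)
  filter_upwards [eventually_termSeq_eq hU w (t i)] with w' h
  rw [h]
  exact hmem i

end Continuity

/-! ### A continuous family of instances of `ECT × WOP (X ↦ X ^ ω)` -/

/-- The codes `Nat.pair 0 i` are ordered as `ω*`; below them, the codes `Nat.pair k i` for `k > 0`
are ordered as the sum over `k ∈ ω` of copies of `ω*`. -/
def ordKey (n : ℕ) : WithTop ℕ ×ₗ ℕᵒᵈ :=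
  toLex (if n.unpair.1 = 0 then ⊤ else (n.unpair.1 : WithTop ℕ), OrderDual.toDual n.unpair.2)

theorem ordKey_lt_iff (a b : ℕ) : ordKey a < ordKey b ↔
    (a.unpair.1 = b.unpair.1 ∧ b.unpair.2 < a.unpair.2) ∨
      (a.unpair.1 ≠ 0 ∧ (b.unpair.1 = 0 ∨ a.unpair.1 < b.unpair.1)) := by
  unfold ordKey
  rw [Prod.Lex.toLex_lt_toLex]
  by_cases ha : a.unpair.1 = 0 <;> by_cases hb : b.unpair.1 = 0 <;>
    simp [ha, hb, eq_comm, or_comm]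

theorem ordKey_injective : Function.Injective ordKey := by
  intro a b h
  have h1 := mt (ordKey_lt_iff a b).2 h.not_lt
  have h2 := mt (ordKey_lt_iff b a).2 h.symm.not_lt
  rw [← Nat.pair_unpair a, ← Nat.pair_unpair b]
  congr 1 <;> omega

/-- The number of steps before `t` at which `w` takes the value `2`. -/
def countTwo (w : ℕ → ℕ) (t : ℕ) : ℕ := Nat.count (fun s => w s = 2) t

/-- The terms of the instance for `w`. -/
def termOf (w : ℕ → ℕ) (t : ℕ) : List (ℕ × ℕ) :=
  [(1, Nat.pair 0 (countTwo w t)), (0, Nat.pair (countTwo w t + 1) t)]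

open Classical in
/-- The instance of `WOP (X ↦ X ^ ω)` that belongs to `w`: when `w` takes the value `2`, the leading
coefficient drops, and the other one jumps up. -/
noncomputable def wopInstance (w : ℕ → ℕ) : ℕ → ℕ :=
  join (fun _ => 1) (join (fun n => if ordKey n.unpair.1 ≤ ordKey n.unpair.2 then 1 else 0)
    fun t => Encodable.encode (termOf w t))

/-- The colouring that belongs to `w`: colour `1` where `w` takes the value `1`, else colour `0`. -/
def ectInstance (w : ℕ → ℕ) : ℕ → ℕ
  | 0 => 2
  | i + 1 => if w i = 1 then 1 else 0

/-- The instance of the product that belongs to `w`. -/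
noncomputable def prodInstance (w : ℕ → ℕ) : ℕ → ℕ := join (ectInstance w) (wopInstance w)

theorem carrier_wopInstance (w : ℕ → ℕ) (a : ℕ) : a ∈ carrier (wopInstance w) := by
  simp [carrier, wopInstance, fstPart_join]

theorem orderRel_wopInstance (w : ℕ → ℕ) (a b : ℕ) :
    orderRel (wopInstance w) a b ↔ ordKey a ≤ ordKey b := by
  simp [orderRel, wopInstance, fstPart_join, sndPart_join]

theorem strict_wopInstance (w : ℕ → ℕ) (a b : ℕ) :
    strict (orderRel (wopInstance w)) a b ↔ ordKey a < ordKey b := by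
  simp only [strict, orderRel_wopInstance, ← lt_iff_le_not_ge]

theorem termSeq_wopInstance (w : ℕ → ℕ) (t : ℕ) : termSeq (wopInstance w) t = termOf w t := by
  simp [termSeq, wopInstance, sndPart_join]

theorem isInstance_wopInstance (w : ℕ → ℕ) : WOPpowOmega.IsInstance (wopInstance w) := by
  refine ⟨?_, fun t => ?_, fun t => ?_⟩
  · simp only [orderRel_wopInstance]
    exact
      { refl := fun a => le_rfl
        trans := fun a b c => le_trans
        antisymm := fun a b h1 h2 => Subtype.ext (ordKey_injective (le_antisymm h1 h2))
        total := fun a b => le_total _ _ }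
  · rw [termSeq_wopInstance]
    -- Every block is a copy of `ω*`, so there is no least element and every coefficient is
    -- admissible.
    refine ⟨by simp [termOf], fun u _ => ⟨carrier_wopInstance w _,
      Nat.pair u.2.unpair.1 (u.2.unpair.2 + 1), carrier_wopInstance w _, ?_⟩⟩
    simp [strict_wopInstance, ordKey_lt_iff]
  · rw [termSeq_wopInstance, termSeq_wopInstance]
    by_cases h : w t = 2
    · refine .rel (.right _ ((strict_wopInstance w _ _).2 ?_))
      simp [ordKey_lt_iff, countTwo, Nat.count_succ, h]
    · have hc : countTwo w (t + 1) = countTwo w t := by simp [countTwo, Nat.count_succ, h]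
      unfold termOf
      rw [hc]
      refine .cons (.rel (.right _ ((strict_wopInstance w _ _).2 ?_)))
      simp [ordKey_lt_iff]

theorem isInstance_prodInstance (w : ℕ → ℕ) :
    (ECT.prod WOPpowOmega).IsInstance (prodInstance w) := by
  refine ⟨fun i => ?_, ?_⟩
  · simp only [prodInstance, fstPart_join, ectInstance]
    split_ifs <;> simp
  · rw [prodInstance, sndPart_join]
    exact isInstance_wopInstance w

theorem countTwo_congr {w w' : ℕ → ℕ} {t : ℕ} (h : ∀ i < t, w' i = w i) :
    countTwo w' t = countTwo w t := by
  induction t with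
  | zero => simp [countTwo]
  | succ t ih =>
    have := ih fun i hi => h i (by omega)
    simp only [countTwo, Nat.count_succ, h t t.lt_succ_self] at this ⊢
    rw [this]

theorem continuous_prodInstance : Continuous prodInstance := by
  have h1 : Continuous ectInstance := by
    refine continuous_pi fun n => ?_
    cases n with
    | zero => exact continuous_const
    | succ i =>
      exact (continuous_of_discreteTopology (f := fun k : ℕ => if k = 1 then 1 else 0)).comp
        (continuous_apply i)
  have h2 : Continuous fun w t => Encodable.encode (termOf w t) := by
    refine continuous_pi fun t => continuous_iff_continuousAt.2 fun w => ?_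
    rw [ContinuousAt, nhds_discrete ℕ, tendsto_pure]
    filter_upwards [(eventually_all_finite (Set.finite_Iio t)).2 fun i _ =>
      eventually_apply_eq w i] with w' hw'
    simp only [termOf, countTwo_congr hw']
  exact h1.join (continuous_const.join (continuous_const.join h2))

/-! ### Which coefficients the solutions use -/

theorem exists_mem_termSeq_wopInstance {w : ℕ → ℕ} {a t : ℕ}
    (h : ∃ b, (b, a) ∈ termSeq (wopInstance w) t) :
    a = Nat.pair 0 (countTwo w t) ∨ a = Nat.pair (countTwo w t + 1) t := by
  obtain ⟨b, h⟩ := h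
  rw [termSeq_wopInstance] at h
  simp only [termOf, List.mem_cons, Prod.mk.injEq, List.not_mem_nil, or_false] at h
  exact h.imp And.right And.right

/-- If the leading coefficient drops only finitely often then a solution does not consist of
leading coefficients. -/
theorem exists_unpair_ne_zero {w z : ℕ → ℕ} {N : ℕ} (hw : ∀ t ≥ N, w t ≠ 2)
    (hz : WOPpowOmega.IsSolution (wopInstance w) z) : ∃ i, (z i).unpair.1 ≠ 0 := by
  by_contra! h0
  obtain ⟨-, hdec, t, -, hmem⟩ := hz
  have hcount : ∀ t, countTwo w t ≤ N := by
    intro t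
    induction t with
    | zero => simp [countTwo]
    | succ t ih =>
      by_cases ht : t < N
      · exact (Nat.count_le _).trans ht
      · have := hw t (by omega)
        simpa [countTwo, Nat.count_succ, this] using ih
  have hval : ∀ i, (z i).unpair.2 ≤ N := by
    intro i
    rcases exists_mem_termSeq_wopInstance (hmem i) with h | h
    · simpa [h] using hcount (t i)
    · simpa [h] using h0 i
  -- Descent inside the top copy of `ω*` means growth of the second index, which is bounded by `N`.
  have hmono : StrictMono fun i => (z i).unpair.2 := strictMono_nat_of_lt_succ fun i => by
    simpa [strict_wopInstance, ordKey_lt_iff, h0] using hdec i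
  exact absurd (hmono.le_apply (x := N + 1)) (by have := hval (N + 1); omega)

/-- If the leading coefficient drops infinitely often then a solution consists of leading
coefficients. -/
theorem unpair_eq_zero {w z : ℕ → ℕ} (hw : ∀ n, ∃ t ≥ n, w t = 2)
    (hz : WOPpowOmega.IsSolution (wopInstance w) z) (i₀ : ℕ) : (z i₀).unpair.1 = 0 := by
  by_contra h0
  obtain ⟨-, hdec, t, ht, hmem⟩ := hz
  simp only [strict_wopInstance, ordKey_lt_iff] at hdec
  have hmono : Monotone (countTwo w) := Nat.count_monotone _
  have hunb : ∀ k, ∃ T, k ≤ countTwo w T := by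
    intro k
    induction k with
    | zero => exact ⟨0, Nat.zero_le _⟩
    | succ k ih =>
      obtain ⟨T, hT⟩ := ih
      obtain ⟨t, ht, h2⟩ := hw T
      refine ⟨t + 1, ?_⟩
      have := hT.trans (hmono ht)
      simpa [countTwo, Nat.count_succ, h2] using this
  -- Once below the top block, a descending sequence stays below it and never enters a higher block.
  have hbd : ∀ j, (z (i₀ + j)).unpair.1 ≠ 0 ∧ (z (i₀ + j)).unpair.1 ≤ (z i₀).unpair.1 := by
    intro j
    induction j with
    | zero => exact ⟨h0, le_rfl⟩
    | succ j ih =>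
      have := hdec (i₀ + j)
      rw [← add_assoc]
      omega
  have hval : ∀ j, z (i₀ + j) = Nat.pair (countTwo w (t (i₀ + j)) + 1) (t (i₀ + j)) := by
    intro j
    refine (exists_mem_termSeq_wopInstance (hmem _)).resolve_left fun h => (hbd j).1 ?_
    simp [h]
  -- The block number `countTwo w t + 1` is monotone in time, so a descent must stay in its block
  -- and strictly increase the time. Times are thus unbounded, and the block number outgrows the
  -- bound `hbd`.
  have htlt : ∀ j, j ≤ t (i₀ + j) := by
    intro j
    induction j with
    | zero => exact Nat.zero_le _
    | succ j ih =>
      have h1 := hdec (i₀ + j)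
      have h2 := hval (j + 1)
      have h3 := hmono (ht (Nat.le_succ (i₀ + j)))
      rw [← add_assoc] at h2 ⊢
      rw [h2, hval j] at h1
      simp only [Nat.unpair_pair, Nat.succ_eq_add_one] at h1 h3
      omega
  obtain ⟨T, hT⟩ := hunb (z i₀).unpair.1
  have h1 := (hbd T).2
  have h2 := hmono (htlt T)
  rw [hval T, Nat.unpair_pair] at h1
  dsimp only at h1
  omega

/-! ### Separation -/

/-- Baire category inside an open set. -/
theorem exists_mem_forall_of_dense {W : Type*} [TopologicalSpace W] [BaireSpace W] {O : Set W}
    (hO : IsOpen O) (hne : O.Nonempty) {E : ℕ → Set W} (hE : ∀ n, IsOpen (E n))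
    (hd : ∀ n, ∀ V ⊆ O, IsOpen V → V.Nonempty → (V ∩ E n).Nonempty) : ∃ w ∈ O, ∀ n, w ∈ E n := by
  -- Adding the exterior of `O` turns density in `O` into density in the whole space.
  have hdense := dense_iInter_of_isOpen_nat (f := fun n => O ∩ E n ∪ (closure O)ᶜ)
    (fun n => (hO.inter (hE n)).union isClosed_closure.isOpen_compl) fun n => by
      refine dense_iff_inter_open.2 fun V hV hVne => ?_
      by_cases h : (V ∩ O).Nonempty
      · obtain ⟨w, hw, hwE⟩ := hd n _ Set.inter_subset_right (hV.inter hO) h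
        exact ⟨w, hw.1, .inl ⟨hw.2, hwE⟩⟩
      · obtain ⟨w, hw⟩ := hVne
        refine ⟨w, hw, .inr fun hcl => h ?_⟩
        exact mem_closure_iff.1 hcl V hV hw
  obtain ⟨w, hwO, hw⟩ := hdense.inter_open_nonempty O hO hne
  refine ⟨w, hwO, fun n => ?_⟩
  rcases Set.mem_iInter.1 hw n with h | h
  · exact h.2
  · exact absurd (subset_closure hwO) h

theorem isOpen_setOf_of_eventually {W : Type*} [TopologicalSpace W] {P : W → Prop}
    (h : ∀ w, P w → ∀ᶠ w' in 𝓝 w, P w') : IsOpen {w | P w} :=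
  isOpen_iff_mem_nhds.2 h

theorem not_prod_le_WOPpowOmega : ¬ WeihrauchLE (ECT.prod WOPpowOmega) WOPpowOmega := by
  rintro ⟨H, K, hH, hK, hred⟩
  choose U hU hUI hsol using fun w => hred (prodInstance w) (isInstance_prodInstance w)
  have hUc : Continuous U := hH.continuous_of_maps continuous_prodInstance hU
  obtain ⟨O, pre, b, s, hO, hOne, hcol, hdense⟩ := exists_column
    (eventually_termSeq_eq hUc) (fun w => (hUI w).2.1) (fun w => (hUI w).2.2)
  have hgeneric : ∀ V ⊆ O, IsOpen V → V.Nonempty → ∃ w ∈ V,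
      (∀ s' ≥ s, ∃ t ≥ s',
        coeffAt pre.length (termSeq (U w) t) ≠ coeffAt pre.length (termSeq (U w) s')) ∧
      ∀ n, ∃ t ≥ n, w t = 2 := by
    intro V hVO hV hVne
    have hA : ∀ n, IsOpen {w | ∃ t ≥ s + n, coeffAt pre.length (termSeq (U w) t) ≠
        coeffAt pre.length (termSeq (U w) (s + n))} := by
      refine fun n => isOpen_setOf_of_eventually fun w ⟨t, ht, hne⟩ => ?_
      filter_upwards [eventually_termSeq_eq hUc w t, eventually_termSeq_eq hUc w (s + n)]
        with w' h1 h2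
      exact ⟨t, ht, by rwa [h1, h2]⟩
    have hB : ∀ n, IsOpen {w : ℕ → ℕ | ∃ t ≥ n, w t = 2} := by
      refine fun n => isOpen_setOf_of_eventually fun w ⟨t, ht, h⟩ => ?_
      filter_upwards [eventually_apply_eq w t] with w' h1
      exact ⟨t, ht, h1.trans h⟩
    obtain ⟨w, hw, hwE⟩ := exists_mem_forall_of_dense hV hVne (fun n => (hA n).inter (hB n))
      fun n V' hV' hV'o hV'ne => by
        obtain ⟨w, hw, hwA⟩ := hdense V' (hV'.trans hVO) hV'o hV'ne (s + n) (by omega)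
        obtain ⟨N, hN⟩ := exists_forall_lt_of_mem_nhds ((hV'o.inter (hA n)).mem_nhds ⟨hw, hwA⟩)
        -- Continuing a long enough initial segment of `w` by `2`s remains in the open set, so the
        -- second condition is dense as well.
        have := hN (fun i => if i < N then w i else 2) fun i hi => by simp [hi]
        exact ⟨_, this.1, this.2, max n N, le_max_left _ _, by simp⟩
    refine ⟨w, hw, fun s' hs' => ?_, fun n => (hwE n).2⟩
    obtain ⟨n, rfl⟩ := Nat.exists_eq_add_of_le hs'
    exact (hwE n).1
  -- a generic parameter, at which the reduction settles for a bound `y₁ 0`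
  obtain ⟨w₁, hw₁O, hdrop₁, -⟩ := hgeneric O subset_rfl hO hOne
  obtain ⟨τ, hτ0, hτ, hτdec, hτmem⟩ :=
    exists_solution_of_column (hUI w₁) (hcol w₁ hw₁O) hdrop₁ le_rfl
  set v₁ : ℕ → ℕ := fun i => coeffAt pre.length (termSeq (U w₁) (τ i)) with hv₁
  obtain ⟨y₁, hy₁, -⟩ := hsol w₁ v₁
    ⟨fun i => mem_carrier_of_mem (hUI w₁) (hτmem i), hτdec, τ, hτ.monotone, hτmem⟩
  obtain ⟨k, hk⟩ := hK.eventually_mem_join continuous_prodInstance (hy₁ 0)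
  obtain ⟨N, hN⟩ := exists_forall_lt_of_mem_nhds
    (hk.and ((eventually_partial_solution hUc (v := v₁) hτdec hτmem k).and
      ((hO.eventually_mem hw₁O).and (eventually_termSeq_eq hUc w₁ (τ k)))))
  -- a parameter at which this bound is wrong
  let M := max N (y₁ 0 + 1)
  -- Colour `1` occurs at `M > y₁ 0` for the last time, and no `2` occurs from `M` on.
  let w₂ : ℕ → ℕ := fun i => if i < M then w₁ i else if i = M then 1 else 0
  obtain ⟨hk₂, ⟨hdec₂, hmem₂⟩, hw₂O, hτ₂⟩ := hN w₂ fun i hi => if_pos (lt_max_of_lt_left hi)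
  -- Such a `v`, put after `v₁ 0, …, v₁ k`, would solve `U w₂` and make `K` repeat the wrong bound
  -- `y₁ 0`.
  have hinext : ∀ v t : ℕ → ℕ, τ k ≤ t 0 → Monotone t →
      (∀ i, strict (orderRel (U w₂)) (v (i + 1)) (v i)) →
      (∀ i, ∃ b, (b, v i) ∈ termSeq (U w₂) (t i)) →
      ¬ strict (orderRel (U w₂)) (v 0) (v₁ k) := by
    intro v t ht0 ht hv hmem hlt
    obtain ⟨y, hy, hyE, -⟩ := hsol w₂ _
      (isSolution_splice (hUI w₂) hτ.monotone hdec₂ hmem₂ ht hv hmem ht0 hlt)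
    have hy0 : y 0 = y₁ 0 := Part.mem_unique (hy 0) (hk₂ _ fun i hi => if_pos hi)
    obtain ⟨z, hz, hcol⟩ := hyE M (by
      rw [fstPart, Nat.mul_zero, hy0]
      exact lt_max_of_lt_right (Nat.lt_succ_self _))
    simp [prodInstance, fstPart_join, ectInstance, w₂, hz.not_gt, hz.ne'] at hcol
  obtain ⟨v, t, ht0, ht, hv, hmem⟩ := exists_solution (hUI w₂) (τ k)
  -- Each tail of `v` also starts late enough for `hinext`.
  have hnot : ∀ i, ¬ strict (orderRel (U w₂)) (v i) (v₁ k) := fun i =>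
    hinext (fun j => v (i + j)) (fun j => t (i + j)) (ht0.trans (ht (Nat.zero_le _)))
      (fun _ _ h => ht (Nat.add_le_add_left h i)) (fun j => hv (i + j)) fun j => hmem (i + j)
  obtain ⟨y₂, hy₂, -, hyW⟩ := hsol w₂ v
    ⟨fun i => mem_carrier_of_mem (hUI w₂) (hmem i), hv, t, ht, hmem⟩
  rw [prodInstance, sndPart_join] at hyW
  obtain ⟨i, hi⟩ := exists_unpair_ne_zero (N := M + 1) (fun t ht => by
    have h1 : ¬ t < M := by omega
    have h2 : t ≠ M := by omega
    simp [w₂, h1, h2]) hyW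
  obtain ⟨k', hk'⟩ := hK.eventually_mem_join continuous_prodInstance (hy₂ (2 * i + 1))
  -- Everything to be kept near `w₂` is a finite amount of information: the output of `K`, the part
  -- of `v` it read, the term at time `τ k`, and the comparison of `v k'` with `v₁ k`.
  have hnear := hk'.and ((eventually_partial_solution hUc hv hmem k').and
      ((hO.eventually_mem hw₂O).and ((eventually_termSeq_eq hUc w₂ (τ k)).and
        ((eventually_orderRel_eq hUc w₂ (v k') (v₁ k)).and
          (eventually_orderRel_eq hUc w₂ (v₁ k) (v k'))))))
  obtain ⟨V, hVsub, hV, hw₂V⟩ := mem_nhds_iff.1 hnear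
  -- a generic parameter at which the reduction gives a wrong entry
  obtain ⟨w₃, hw₃V, hdrop₃, htwo⟩ := hgeneric V (fun w hw => (hVsub hw).2.2.1) hV ⟨w₂, hw₂V⟩
  obtain ⟨hk₃, ⟨hdec₃, hmem₃⟩, hw₃O, hτ₃, hr₁, hr₂⟩ := hVsub hw₃V
  have hsτ : s ≤ τ k := hτ0 ▸ hτ.monotone (Nat.zero_le k)
  obtain ⟨τ', hτ'0, hτ', hτ'dec, hτ'mem⟩ := exists_solution_of_column (hUI w₃) (hcol w₃ hw₃O) hdrop₃
    (hsτ.trans (le_max_left (τ k) (t k')))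
  have hcarr : ∀ i, coeffAt pre.length (termSeq (U w₃) (τ' i)) ∈ carrier (U w₃) := fun i =>
    mem_carrier_of_mem (hUI w₃) (hτ'mem i)
  have hv₁k : coeffAt pre.length (termSeq (U w₃) (τ k)) = v₁ k := by rw [hτ₃, hτ₂]
  have hcarr₁ : v₁ k ∈ carrier (U w₃) :=
    hv₁k ▸ mem_carrier_of_mem (hUI w₃) ⟨_, (hcol w₃ hw₃O).mem hsτ⟩
  -- At `τ k` the column still shows `v₁ k`. At `τ' 0` it may be unchanged, so the continuation
  -- starts at `τ' 1`, after one certain drop.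
  have hlt₁ : strict (orderRel (U w₃)) (coeffAt pre.length (termSeq (U w₃) (τ' 1))) (v₁ k) := by
    rcases (hcol w₃ hw₃O).coeff_le (hUI w₃).1 (hUI w₃).2.1 (hUI w₃).2.2 hsτ
      (hτ'0 ▸ le_max_left (τ k) (t k') : τ k ≤ τ' 0) with h | h
    · rw [← hv₁k, ← h]
      exact hτ'dec 0
    · rw [hv₁k] at h
      exact strict_trans (hUI w₃).1 (hcarr 1) (hcarr 0) hcarr₁ (hτ'dec 0) h
  -- By `hnot`, carried over to `w₃`, the entry `v k'` is not below `v₁ k`, which the column has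
  -- already passed.
  have hlt : strict (orderRel (U w₃)) (coeffAt pre.length (termSeq (U w₃) (τ' 1))) (v k') := by
    refine strict_of_strict_of_not_strict (hUI w₃).1 (hcarr 1) hcarr₁
      (mem_carrier_of_mem (hUI w₃) (hmem₃ k' le_rfl)) hlt₁ ?_
    simpa only [strict, hr₁, hr₂] using hnot k'
  obtain ⟨y₃, hy₃, -, hyW₃⟩ := hsol w₃ _ (isSolution_splice (hUI w₃) ht hdec₃ hmem₃
    (v' := fun i => coeffAt pre.length (termSeq (U w₃) (τ' (i + 1)))) (t' := fun i => τ' (i + 1))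
    (fun _ _ h => hτ'.monotone (Nat.succ_le_succ h)) (fun i => hτ'dec (i + 1))
    (fun i => hτ'mem (i + 1))
    ((le_max_right (τ k) (t k')).trans (hτ'0 ▸ hτ'.monotone (Nat.zero_le _))) hlt)
  have hy : y₃ (2 * i + 1) = y₂ (2 * i + 1) :=
    Part.mem_unique (hy₃ _) (hk₃ _ fun i hi => if_pos hi)
  rw [prodInstance, sndPart_join] at hyW₃
  have hzero := unpair_eq_zero htwo hyW₃ i
  rw [sndPart, hy] at hzero
  exact hi hzero

end Weihrauch

theorem mainTheorem12 :
    Weihrauch.WeihrauchLT Weihrauch.WOPpowOmega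
      (Weihrauch.Problem.prod Weihrauch.ECT Weihrauch.WOPpowOmega) :=
  ⟨Weihrauch.WOPpowOmega_le_prod, Weihrauch.not_prod_le_WOPpowOmega⟩
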